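/- Let $c_0$ be the Banach space of real null sequences $(x_n)_{n\in\mathbb N}$ with the sup norm. Call an operator $T$ on $c_0$ positive if $Tx\ge 0$ (pointwise) whenever $x\ge 0$; mean ergodic if $\lim_{n\to\infty}\frac1n\sum_{k=0}^{n-1}T^kx$ exists in norm for every $x\in c_0$; and weakly almost periodic if $\{T^nx : n\in\mathbb N\}$ is relatively weakly compact for every $x\in c_0$. Consider the weighted directed graph with the pairwise distinct vertices $s$; $o_k$, $v_k$ $(k\ge 0)$; $s_{k,n}$ $(k\ge 0,\ n\ge k+1)$; $t_{k,j}$ $(k\ge 0,\ j\ge 1)$. Put $t_{k,0}:=v_k$ and $r_n:=2^{n+1}-n-2$ for $n\ge 1$. The edges, for all admissible indices, are $s\to o_0$, $o_k\to o_{k+1}$, $o_k\to s_{k,k+1}$ and $s_{k,n}\to s_{k,n+1}$, each of weight $1$; $s_{k,n}\to t_{k,r_n}$ of weight $\frac12$; and $t_{k,j+1}\to t_{k,j}$ $(j\ge 0)$, of weight $2$ if $j+1\in\{r_1,r_2,\dots\}$, of weight $\frac12$ if $j\in\{r_1,r_2,\dots\}$, and of weight $1$ otherwise. All other pairs of vertices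 have weight $0$. Then the vertices can be enumerated by $\mathbb N$ so that the resulting weight function $w:\mathbb N^2\to[0,\infty)$, where $w(u,v)$ is the weight of the edge from $u$ to $v$, satisfies $\lim_{k\to\infty}w(u,k)=0$ for every $u$ and $\sup_u\sum_k w(k,u)<\infty$, and the formula $(Tx)_u=\sum_n x_n\,w(n,u)$ defines a positive bounded linear operator $T:c_0\to c_0$ such that $\|T^n\|\le 4$ for all $n$, every power $T^m$ is mean ergodic, and $T$ is not weakly almost periodic. In particular, there is a positive operator $T$ on $c_0$ with $\|T^n\|\le 4$ for all $n$, all of whose powers are mean ergodic, but which is not weakly almost periodic. -/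

import Mathlib

open Filter Topology
open scoped ZeroAtInfty

/-- An operator on `c₀` (real null sequences indexed by `ℕ`, with the sup norm) is positive if it
maps pointwise nonnegative sequences to pointwise nonnegative sequences. -/
def IsPositiveOp (T : C₀(ℕ, ℝ) →L[ℝ] C₀(ℕ, ℝ)) : Prop :=
  ∀ x : C₀(ℕ, ℝ), (∀ n, 0 ≤ x n) → ∀ n, 0 ≤ T x n

/-- Mean ergodicity: the Cesàro averages `(1/n) ∑_{k<n} T^k x` converge in norm for every `x`. -/
def IsMeanErgodic {X : Type*} [NormedAddCommGroup X] [NormedSpace ℝ X] (T : X →L[ℝ] X) : Prop :=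
  ∀ x : X, ∃ y : X,
    Tendsto (fun n : ℕ => (n : ℝ)⁻¹ • ∑ k ∈ Finset.range n, (T ^ k) x) atTop (𝓝 y)

/-- Weak almost periodicity: every orbit is relatively compact in the weak topology. -/
def IsWeaklyAlmostPeriodic {X : Type*} [NormedAddCommGroup X] [NormedSpace ℝ X]
    (T : X →L[ℝ] X) : Prop :=
  ∀ x : X, IsCompact (closure (Set.range fun n : ℕ => toWeakSpace ℝ X ((T ^ n) x)))

/-- A `c₀`-graph: a weighted directed graph on `ℕ`, `w u v` being the weight of the edge from
`u` to `v` (weight `0` stands for a missing edge), such that the outgoing weights of every vertex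
form a null sequence and the sums of incoming weights are uniformly bounded. -/
structure IsC0Graph (w : ℕ → ℕ → ℝ) : Prop where
  nonneg : ∀ u v, 0 ≤ w u v
  tendsto_zero : ∀ u, Tendsto (fun k => w u k) atTop (𝓝 0)
  bounded : ∃ C : ℝ, ∀ u, Summable (fun k => w k u) ∧ ∑' k, w k u ≤ C

/-- `T` is the operator on `c₀` associated with the graph `w`: `(T x)_u = ∑_n x_n w(n,u)`. -/
def IsAssociatedOp (w : ℕ → ℕ → ℝ) (T : C₀(ℕ, ℝ) →L[ℝ] C₀(ℕ, ℝ)) : Prop :=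
  ∀ (x : C₀(ℕ, ℝ)) (u : ℕ), HasSum (fun n => x n * w n u) (T x u)

/-- The vertices of the graph obtained by connecting the modified ladders `G_0, G_1, G_2, …`. -/
inductive LadderVertex : Type
  /-- the vertex `s` -/
  | source : LadderVertex
  /-- the vertex `o_k` of `G_k` -/
  | origin (k : ℕ) : LadderVertex
  /-- the vertex `s_{k+1+i}` of `G_k`; the vertices `s_1, …, s_k` are lacking in `G_k` -/
  | upper (k i : ℕ) : LadderVertex
  /-- the vertex `v_k` of `G_k` if `j = 0`, the vertex `t_j` of `G_k` if `1 ≤ j` -/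
  | lower (k j : ℕ) : LadderVertex

/-- The rung starting in `s_n` ends in `t_j` with `j = 2^(n+1) - n - 2`, i.e. `1, 4, 11, 26, …`
for `n = 1, 2, 3, 4, …` (the subtraction does not truncate). -/
def rungFoot (n : ℕ) : ℕ := 2 ^ (n + 1) - n - 2

/-- The rung positions `1, 4, 11, 26, …` of the full ladder `G_0`. -/
def IsRungFoot (j : ℕ) : Prop := ∃ n : ℕ, 1 ≤ n ∧ j = rungFoot n

open Classical in
/-- `ladderWeight a b` is the weight of the edge from `a` to `b`. The edges are
`s → o_0`, `o_k → o_{k+1}`, `o_k → s_{k+1}`, `s_n → s_{n+1}` (weight `1`), the rungs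
`s_n → t_{rungFoot n}` (weight `1/2`), and `t_{j+1} → t_j` (with `t_0 = v_k`), whose weight is `2`
if it leaves a rung position, `1/2` if it enters a rung position and `1` otherwise. -/
noncomputable def ladderWeight : LadderVertex → LadderVertex → ℝ
  | .source, .origin l => if l = 0 then 1 else 0
  | .origin k, .origin l => if l = k + 1 then 1 else 0
  | .origin k, .upper l i => if l = k ∧ i = 0 then 1 else 0
  | .upper k i, .upper l i' => if l = k ∧ i' = i + 1 then 1 else 0
  | .upper k i, .lower l j => if l = k ∧ j = rungFoot (k + 1 + i) then 1 / 2 else 0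
  | .lower k j', .lower l j =>
      if l = k ∧ j' = j + 1 then
        if IsRungFoot (j + 1) then 2 else if IsRungFoot j then 1 / 2 else 1
      else 0
  | _, _ => 0

/-!
The operator moves mass along the edges of the graph, so the entries of `T ^ n` are the total weights
of the paths of length `n`.

On a lower line the weights are quotients `lowerScale j / lowerScale (j + 1)` of a function with values
in `{1 / 2, 1}`, and a rung ending at `t_j` has weight `lowerScale j`. Hence each lower line is a
rescaled unweighted shift fed by unweighted rungs. The rung positions `rungFoot m = 2 ^ (m + 1) - m - 2`
are so sparse that at most one rung contributes to a given vertex at a given time. This yields an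
explicit function `pathBound n ≤ 3` with `|(T ^ n) x| ≤ pathBound n * ‖x‖`, and so power boundedness
(`IsAssociatedOp.norm_pow_le`).

The position of the rungs is chosen so that all paths from the source `s` to `v_k` through the rung
number `m` have length `2 ^ (m + 1)`, independently of `k`. The orbit of the unit vector `e_s` can be
computed exactly (`sourceOrbit`). At the times `2 ^ (m + 1)` it takes the value `1` at `v_0, …, v_{m-1}`,
so a weak cluster point would take the value `1` at all `v_k` and could not be a null sequence.
On the other hand, any vertex is charged at times that at least double from one to the next
(`two_mul_le_of_sourceOrbit_ne_zero`), so the partial sums of the orbit of `e_s` over `n < N` are bounded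
by `log₂ N + 2`, uniformly over the vertices. Since every vertex is reached from `s`, the orbit of `e_s`
dominates every unit vector up to a factor `2`, and positivity transfers the bound `o(N)` to all unit
vectors and all powers of `T` (`IsPositiveOp.isMeanErgodic_pow`). Power boundedness and density give
mean ergodicity on all of `c₀`.
-/

/-! ### The space of null sequences -/

theorem C0.norm_le_iff {x : C₀(ℕ, ℝ)} {M : ℝ} (hM : 0 ≤ M) : ‖x‖ ≤ M ↔ ∀ n, |x n| ≤ M := by
  rw [← ZeroAtInftyContinuousMap.norm_toBCF_eq_norm, BoundedContinuousFunction.norm_le hM]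
  rfl

theorem C0.abs_apply_le_norm (x : C₀(ℕ, ℝ)) (n : ℕ) : |x n| ≤ ‖x‖ :=
  (C0.norm_le_iff (norm_nonneg x)).1 le_rfl n

theorem C0.tendsto_zero (x : C₀(ℕ, ℝ)) : Tendsto x atTop (𝓝 0) := by
  have h := x.zero_at_infty'
  rw [cocompact_eq_cofinite, Nat.cofinite_eq_atTop] at h
  exact h

/-- A null sequence of real numbers as an element of `c₀`. -/
def C0.mk (f : ℕ → ℝ) (hf : Tendsto f atTop (𝓝 0)) : C₀(ℕ, ℝ) where
  toFun := f
  continuous_toFun := continuous_of_discreteTopology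
  zero_at_infty' := by rwa [cocompact_eq_cofinite, Nat.cofinite_eq_atTop]

@[simp]
theorem C0.mk_apply (f : ℕ → ℝ) (hf : Tendsto f atTop (𝓝 0)) (n : ℕ) : C0.mk f hf n = f n := rfl

/-- The `n`-th unit vector of `c₀`. -/
def C0.single (n : ℕ) : C₀(ℕ, ℝ) :=
  C0.mk (Pi.single n 1) <| tendsto_const_nhds.congr' <| by
    filter_upwards [eventually_gt_atTop n] with k hk
    simp [hk.ne']

theorem C0.single_apply (n k : ℕ) : C0.single n k = if k = n then 1 else 0 := by
  simp [C0.single, Pi.single_apply]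

/-- Evaluation at `n` as a continuous linear functional on `c₀`. -/
noncomputable def C0.eval (n : ℕ) : C₀(ℕ, ℝ) →L[ℝ] ℝ :=
  LinearMap.mkContinuous
    { toFun := fun x => x n
      map_add' := fun _ _ => rfl
      map_smul' := fun _ _ => rfl } 1 fun x => by simpa using C0.abs_apply_le_norm x n

@[simp]
theorem C0.eval_apply (n : ℕ) (x : C₀(ℕ, ℝ)) : C0.eval n x = x n := rfl

theorem C0.sum_apply {ι : Type*} (s : Finset ι) (f : ι → C₀(ℕ, ℝ)) (n : ℕ) :
    (∑ i ∈ s, f i) n = ∑ i ∈ s, f i n := by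
  exact map_sum (C0.eval n) f s

/-- The unit vectors have dense span: every null sequence is the limit of its truncations. -/
theorem C0.tendsto_sum_single (x : C₀(ℕ, ℝ)) :
    Tendsto (fun N => ∑ n ∈ Finset.range N, x n • C0.single n) atTop (𝓝 x) := by
  rw [Metric.tendsto_atTop]
  intro ε hε
  obtain ⟨N, hN⟩ := Metric.tendsto_atTop.1 (C0.tendsto_zero x) (ε / 2) (half_pos hε)
  refine ⟨N, fun m hm => ?_⟩
  rw [dist_eq_norm]
  refine lt_of_le_of_lt ((C0.norm_le_iff (half_pos hε).le).2 fun k => ?_) (half_lt_self hε)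
  have hk : (∑ n ∈ Finset.range m, x n • C0.single n) k = if k < m then x k else 0 := by
    simp [C0.sum_apply, C0.single_apply]
  rw [ZeroAtInftyContinuousMap.sub_apply, hk]
  split_ifs with h
  · simpa using (half_pos hε).le
  · simpa [Real.dist_eq] using (hN k (by omega)).le

/-! ### The operator associated with a graph -/

theorem IsC0Graph.summable_mul {w : ℕ → ℕ → ℝ} (hw : IsC0Graph w) (x : C₀(ℕ, ℝ)) (u : ℕ) :
    Summable fun n => x n * w n u := by
  obtain ⟨C, hC⟩ := hw.bounded
  refine Summable.of_norm_bounded ((hC u).1.mul_left ‖x‖) fun n => ?_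
  rw [Real.norm_eq_abs, abs_mul, abs_of_nonneg (hw.nonneg n u)]
  exact mul_le_mul_of_nonneg_right (C0.abs_apply_le_norm x n) (hw.nonneg n u)

theorem IsC0Graph.exists_bound {w : ℕ → ℕ → ℝ} (hw : IsC0Graph w) :
    ∃ C : ℝ, 0 ≤ C ∧ ∀ (f : ℕ → ℝ) (M : ℝ) (u : ℕ), (∀ n, |f n| ≤ M) →
      |∑' n, f n * w n u| ≤ M * C := by
  obtain ⟨C, hC⟩ := hw.bounded
  refine ⟨C, (tsum_nonneg fun n => hw.nonneg n 0).trans (hC 0).2, fun f M u hf => ?_⟩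
  have h := tsum_of_norm_bounded (f := fun n => f n * w n u) ((hC u).1.mul_left M).hasSum
    fun n => by
      rw [Real.norm_eq_abs, abs_mul, abs_of_nonneg (hw.nonneg n u)]
      exact mul_le_mul_of_nonneg_right (hf n) (hw.nonneg n u)
  rw [tsum_mul_left] at h
  exact h.trans (mul_le_mul_of_nonneg_left (hC u).2 ((abs_nonneg _).trans (hf 0)))

/-- The image of a null sequence is a null sequence: up to a uniformly small error the sum runs over
finitely many vertices, whose outgoing weights are null sequences. -/
theorem IsC0Graph.tendsto_tsum {w : ℕ → ℕ → ℝ} (hw : IsC0Graph w) (x : C₀(ℕ, ℝ)) :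
    Tendsto (fun u => ∑' n, x n * w n u) atTop (𝓝 0) := by
  obtain ⟨C, hC0, hC⟩ := hw.exists_bound
  rw [Metric.tendsto_atTop]
  intro ε hε
  have hδ : 0 < ε / (2 * (C + 1)) := by positivity
  obtain ⟨N, hN⟩ := Metric.tendsto_atTop.1 (C0.tendsto_zero x) _ hδ
  have hfin : Tendsto (fun u => ∑ n ∈ Finset.range N, x n * w n u) atTop (𝓝 0) := by
    simpa using tendsto_finsetSum (Finset.range N) fun n _ => (hw.tendsto_zero n).const_mul (x n)
  obtain ⟨K, hK⟩ := Metric.tendsto_atTop.1 hfin (ε / 2) (half_pos hε)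
  refine ⟨K, fun u hu => ?_⟩
  have htail := hC (fun n => if n < N then 0 else x n) _ u fun n => (by
    split_ifs with h
    · simpa using hδ.le
    · simpa [Real.dist_eq] using (hN n (by omega)).le : _ ≤ ε / (2 * (C + 1)))
  have hsplit : ∑' n, x n * w n u = ∑ n ∈ Finset.range N, x n * w n u
      + ∑' n, (if n < N then 0 else x n) * w n u := by
    have h1 : HasSum (fun n => (if n < N then x n else 0) * w n u)
        (∑ n ∈ Finset.range N, x n * w n u) := by
      rw [Finset.sum_congr rfl fun n hn => by rw [← if_pos (c := n < N) (t := x n) (e := 0)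
        (Finset.mem_range.1 hn)]]
      exact hasSum_sum_of_ne_finset_zero fun n hn => by simp_all
    have h2 := (hw.summable_mul x u).hasSum.sub h1
    have h3 : (fun n => x n * w n u - (if n < N then x n else 0) * w n u)
        = fun n => (if n < N then 0 else x n) * w n u := by
      funext n; split_ifs <;> ring
    rw [h3] at h2
    rw [h2.tsum_eq]; ring
  have hlt : ε / (2 * (C + 1)) * C < ε / 2 := by
    rw [div_mul_eq_mul_div, div_lt_div_iff₀ (by positivity) two_pos]
    nlinarith
  have h4 := hK u hu
  rw [Real.dist_eq, sub_zero] at h4 ⊢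
  rw [hsplit]
  linarith [abs_add_le (∑ n ∈ Finset.range N, x n * w n u)
    (∑' n, (if n < N then 0 else x n) * w n u)]

theorem IsC0Graph.exists_isAssociatedOp {w : ℕ → ℕ → ℝ} (hw : IsC0Graph w) :
    ∃ T : C₀(ℕ, ℝ) →L[ℝ] C₀(ℕ, ℝ), IsAssociatedOp w T := by
  obtain ⟨C, hC0, hC⟩ := hw.exists_bound
  let L : C₀(ℕ, ℝ) →ₗ[ℝ] C₀(ℕ, ℝ) :=
    { toFun := fun x => C0.mk (fun u => ∑' n, x n * w n u) (hw.tendsto_tsum x)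
      map_add' := fun x y => by
        ext u
        simp [add_mul, (hw.summable_mul x u).tsum_add (hw.summable_mul y u)]
      map_smul' := fun c x => by
        ext u
        simp [mul_assoc, tsum_mul_left] }
  refine ⟨L.mkContinuous C fun x => ?_, fun x u => (hw.summable_mul x u).hasSum⟩
  refine (C0.norm_le_iff (by positivity)).2 fun u => ?_
  rw [mul_comm]
  exact hC x ‖x‖ u (C0.abs_apply_le_norm x)

theorem IsAssociatedOp.isPositiveOp {w : ℕ → ℕ → ℝ} {T : C₀(ℕ, ℝ) →L[ℝ] C₀(ℕ, ℝ)}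
    (hT : IsAssociatedOp w T) (hw : ∀ u v, 0 ≤ w u v) : IsPositiveOp T :=
  fun x hx u => (hT x u).nonneg fun n => mul_nonneg (hx n) (hw n u)

theorem IsPositiveOp.pow {T : C₀(ℕ, ℝ) →L[ℝ] C₀(ℕ, ℝ)} (hT : IsPositiveOp T) (n : ℕ) :
    IsPositiveOp (T ^ n) := by
  induction n with
  | zero => exact fun x hx => hx
  | succ n ih =>
    intro x hx
    rw [pow_succ']
    exact hT _ (ih x hx)

theorem IsPositiveOp.mono {T : C₀(ℕ, ℝ) →L[ℝ] C₀(ℕ, ℝ)} (hT : IsPositiveOp T) {x y : C₀(ℕ, ℝ)}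
    (hxy : ∀ n, x n ≤ y n) (n : ℕ) : T x n ≤ T y n := by
  have h := hT (y - x) (fun k => by simpa using hxy k) n
  rw [map_sub] at h
  simpa using h

/-! ### Mean ergodicity and weak almost periodicity on the space of null sequences -/

/-- The Cesàro averages of a power bounded operator are uniformly bounded, so their convergence to
`0` on the unit vectors passes to all of `c₀`. -/
theorem isMeanErgodic_of_tendsto_single {T : C₀(ℕ, ℝ) →L[ℝ] C₀(ℕ, ℝ)} {M : ℝ}
    (hM : ∀ n, ‖T ^ n‖ ≤ M)
    (h : ∀ u, Tendsto (fun N : ℕ => (N : ℝ)⁻¹ • ∑ k ∈ Finset.range N, (T ^ k) (C0.single u))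
      atTop (𝓝 0)) : IsMeanErgodic T := by
  have hM0 : 0 ≤ M := (ContinuousLinearMap.opNorm_nonneg _).trans (hM 0)
  have hbound (N : ℕ) (z : C₀(ℕ, ℝ)) :
      ‖(N : ℝ)⁻¹ • ∑ k ∈ Finset.range N, (T ^ k) z‖ ≤ M * ‖z‖ := by
    have h1 : ‖∑ k ∈ Finset.range N, (T ^ k) z‖ ≤ N * (M * ‖z‖) := by
      refine (norm_sum_le_of_le _ fun k _ => (T ^ k).le_of_opNorm_le (hM k) z).trans ?_
      simp
    rw [norm_smul, norm_inv, Real.norm_natCast]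
    rcases N.eq_zero_or_pos with rfl | hN
    · simp; positivity
    · have hN' : (0 : ℝ) < N := by exact_mod_cast hN
      rw [inv_mul_le_iff₀ hN']
      exact h1
  refine fun x => ⟨0, Metric.tendsto_atTop.2 fun ε hε => ?_⟩
  have hδ : 0 < ε / (2 * (M + 1)) := by positivity
  obtain ⟨K, hK⟩ := Metric.tendsto_atTop.1 (C0.tendsto_sum_single x) _ hδ
  set z := ∑ n ∈ Finset.range K, x n • C0.single n
  have hz : Tendsto (fun N : ℕ => (N : ℝ)⁻¹ • ∑ k ∈ Finset.range N, (T ^ k) z) atTop (𝓝 0) := by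
    have h2 := tendsto_finsetSum (Finset.range K) fun n _ => (h n).const_smul (x n)
    simp only [smul_zero, Finset.sum_const_zero] at h2
    refine h2.congr fun N => ?_
    simp only [z, map_sum, map_smul]
    rw [Finset.sum_comm, Finset.smul_sum]
    refine Finset.sum_congr rfl fun n _ => ?_
    rw [smul_comm, Finset.smul_sum]
  obtain ⟨N₀, hN₀⟩ := Metric.tendsto_atTop.1 hz (ε / 2) (half_pos hε)
  refine ⟨N₀, fun N hN => ?_⟩
  have h3 := hN₀ N hN
  have h4 := hbound N (x - z)
  have h5 : ‖x - z‖ ≤ ε / (2 * (M + 1)) := by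
    have := (hK K le_rfl).le
    rwa [dist_comm, dist_eq_norm] at this
  have h6 : M * (ε / (2 * (M + 1))) < ε / 2 := by
    rw [← mul_div_assoc, div_lt_div_iff₀ (by positivity) two_pos]
    nlinarith
  rw [dist_zero_right] at h3 ⊢
  have h7 : (N : ℝ)⁻¹ • ∑ k ∈ Finset.range N, (T ^ k) x
      = (N : ℝ)⁻¹ • ∑ k ∈ Finset.range N, (T ^ k) (x - z)
        + (N : ℝ)⁻¹ • ∑ k ∈ Finset.range N, (T ^ k) z := by
    ext v
    simp [C0.sum_apply]
    ring
  rw [h7]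
  have h8 := mul_le_mul_of_nonneg_left h5 hM0
  linarith [norm_add_le ((N : ℝ)⁻¹ • ∑ k ∈ Finset.range N, (T ^ k) (x - z))
    ((N : ℝ)⁻¹ • ∑ k ∈ Finset.range N, (T ^ k) z)]

theorem isMeanErgodic_one {X : Type*} [NormedAddCommGroup X] [NormedSpace ℝ X] :
    IsMeanErgodic (1 : X →L[ℝ] X) := by
  refine fun x => ⟨x, tendsto_const_nhds.congr' ?_⟩
  filter_upwards [eventually_gt_atTop 0] with n hn
  have : (n : ℝ) ≠ 0 := by positivity
  simp [← Nat.cast_smul_eq_nsmul ℝ, smul_smul, this]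

/-- If the orbit of a single positive vector `s` dominates every unit vector and has partial sums of
size `o(N)`, then all powers of `T` are mean ergodic: the sums along the subsequence `m * k` are
dominated by full partial sums of the orbit of `s`. -/
theorem IsPositiveOp.isMeanErgodic_pow {T : C₀(ℕ, ℝ) →L[ℝ] C₀(ℕ, ℝ)} (hT : IsPositiveOp T) {M : ℝ}
    (hM : ∀ n, ‖T ^ n‖ ≤ M) {s : C₀(ℕ, ℝ)} (hs : ∀ n, 0 ≤ s n)
    (hdom : ∀ u, ∃ (p : ℕ) (c : ℝ), 0 ≤ c ∧ ∀ v, C0.single u v ≤ c * (T ^ p) s v)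
    (hlim : Tendsto (fun N : ℕ => (N : ℝ)⁻¹ * ‖∑ n ∈ Finset.range N, (T ^ n) s‖) atTop (𝓝 0))
    (m : ℕ) : IsMeanErgodic (T ^ m) := by
  rcases m.eq_zero_or_pos with rfl | hm
  · exact isMeanErgodic_one
  refine isMeanErgodic_of_tendsto_single (M := M) (fun n => by rw [← pow_mul]; exact hM _)
    fun u => ?_
  obtain ⟨p, c, hc, hp⟩ := hdom u
  have hsum (N : ℕ) : ‖∑ k ∈ Finset.range N, ((T ^ m) ^ k) (C0.single u)‖
      ≤ c * ‖∑ n ∈ Finset.range (m * N + p), (T ^ n) s‖ := by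
    refine (C0.norm_le_iff (by positivity)).2 fun v => ?_
    have hpos : 0 ≤ (∑ k ∈ Finset.range N, ((T ^ m) ^ k) (C0.single u)) v := by
      rw [C0.sum_apply]
      exact Finset.sum_nonneg fun k _ => (hT.pow m).pow k _ (fun n => by
        rw [C0.single_apply]; split_ifs <;> norm_num) v
    rw [abs_of_nonneg hpos]
    refine le_trans ?_ (mul_le_mul_of_nonneg_left
      ((le_abs_self _).trans (C0.abs_apply_le_norm _ v)) hc)
    rw [C0.sum_apply, C0.sum_apply, Finset.mul_sum]
    calc ∑ k ∈ Finset.range N, ((T ^ m) ^ k) (C0.single u) v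
        ≤ ∑ k ∈ Finset.range N, c * (T ^ (m * k + p)) s v := by
          refine Finset.sum_le_sum fun k _ => ?_
          have h1 := ((hT.pow m).pow k).mono (y := c • (T ^ p) s) hp v
          rw [map_smul, ← mul_apply_eq_comp, ← pow_mul, ← pow_add] at h1
          rw [← pow_mul]
          exact h1
      _ = ∑ n ∈ (Finset.range N).image fun k => m * k + p, c * (T ^ n) s v := by
          rw [Finset.sum_image]
          intro a _ b _ hab
          exact Nat.eq_of_mul_eq_mul_left hm (Nat.add_right_cancel hab)
      _ ≤ ∑ n ∈ Finset.range (m * N + p), c * (T ^ n) s v := by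
          refine Finset.sum_le_sum_of_subset_of_nonneg ?_ fun n _ _ =>
            mul_nonneg hc (hT.pow n s hs v)
          intro n hn
          obtain ⟨k, hk, rfl⟩ := Finset.mem_image.1 hn
          have := Nat.mul_lt_mul_of_pos_left (Finset.mem_range.1 hk) hm
          exact Finset.mem_range.2 (by omega)
  have hshift : Tendsto (fun N : ℕ => m * N + p) atTop atTop :=
    tendsto_atTop_mono (fun N => (Nat.le_mul_of_pos_left N hm).trans (Nat.le_add_right _ _))
      tendsto_id
  have hlim' := ((hlim.comp hshift).const_mul (c * (m + p)))
  rw [mul_zero] at hlim'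
  refine squeeze_zero_norm' ?_ hlim'
  filter_upwards [eventually_gt_atTop 0] with N hN
  have hN' : (1 : ℝ) ≤ N := by exact_mod_cast hN
  have hm' : (1 : ℝ) ≤ m := by exact_mod_cast hm
  have hp' : (0 : ℝ) ≤ p := p.cast_nonneg
  rw [norm_smul, norm_inv, Real.norm_natCast]
  refine (mul_le_mul_of_nonneg_left (hsum N) (by positivity)).trans ?_
  simp only [Function.comp_apply]
  set S := ‖∑ n ∈ Finset.range (m * N + p), (T ^ n) s‖
  have hinv : (N : ℝ)⁻¹ ≤ (m + p) * ((m * N + p : ℕ) : ℝ)⁻¹ := by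
    push_cast
    rw [← div_eq_mul_inv, le_div_iff₀ (by positivity), inv_mul_le_iff₀ (by positivity)]
    nlinarith
  calc (N : ℝ)⁻¹ * (c * S) ≤ ((m + p) * ((m * N + p : ℕ) : ℝ)⁻¹) * (c * S) :=
        mul_le_mul_of_nonneg_right hinv (by positivity)
    _ = _ := by ring

/-- A weak cluster point of the iterates `T ^ a m x` would take the value `1` at all places `b k`,
which is impossible for a null sequence. -/
theorem not_isWeaklyAlmostPeriodic_of_eventually_eq_one {T : C₀(ℕ, ℝ) →L[ℝ] C₀(ℕ, ℝ)}
    {x : C₀(ℕ, ℝ)} (a : ℕ → ℕ) {b : ℕ → ℕ} (hb : Function.Injective b)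
    (h : ∀ k, ∀ᶠ m in atTop, (T ^ a m) x (b k) = 1) : ¬ IsWeaklyAlmostPeriodic T := by
  intro hT
  obtain ⟨y, -, hy⟩ := (hT x).exists_mapClusterPt (f := atTop)
    (u := fun m => toWeakSpace ℝ C₀(ℕ, ℝ) ((T ^ a m) x))
    (tendsto_principal.2 (Eventually.of_forall fun m => subset_closure ⟨a m, rfl⟩))
  obtain ⟨z, rfl⟩ := (toWeakSpace ℝ C₀(ℕ, ℝ)).surjective y
  have hz (k : ℕ) : z (b k) = 1 := by
    by_contra hne
    have hcont : Continuous fun y : WeakSpace ℝ C₀(ℕ, ℝ) =>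
        C0.eval (b k) ((toWeakSpace ℝ C₀(ℕ, ℝ)).symm y) :=
      WeakBilin.eval_continuous (topDualPairing ℝ C₀(ℕ, ℝ)).flip (C0.eval (b k))
    have hfreq := (hy.continuousAt_comp hcont.continuousAt).frequently
      (p := fun r : ℝ => r ≠ 1) (isOpen_ne.mem_nhds hne)
    exact hfreq ((h k).mono fun m hm => by simpa using hm)
  have hlim : Tendsto (fun k => z (b k)) atTop (𝓝 0) :=
    (C0.tendsto_zero z).comp hb.nat_tendsto_atTop
  simp only [hz] at hlim
  exact one_ne_zero (tendsto_nhds_unique tendsto_const_nhds hlim)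

/-! ### Rung positions -/

theorem rungFoot_add (n : ℕ) : rungFoot n + (n + 2) = 2 ^ (n + 1) := by
  have : n + 2 ≤ 2 ^ (n + 1) := Nat.lt_two_pow_self (n := n + 1)
  unfold rungFoot
  omega

theorem le_rungFoot {n : ℕ} (hn : 1 ≤ n) : n ≤ rungFoot n := by
  induction n, hn using Nat.le_induction with
  | base => decide
  | succ n hn ih =>
    have h1 := rungFoot_add n
    have h2 := rungFoot_add (n + 1)
    rw [pow_succ] at h2
    omega

/-- The gap between consecutive rung positions `rungFoot n` exceeds the length `n + 2` of the
window during which mass enters the lower line through the rung at `rungFoot n`. -/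
theorem rungFoot_gap {m n : ℕ} (hm : 1 ≤ m) (h : m < n) : rungFoot m + m + 2 ≤ rungFoot n := by
  induction n, h using Nat.le_induction with
  | base =>
    rw [Nat.succ_eq_add_one]
    have h1 := rungFoot_add m
    have h2 := rungFoot_add (m + 1)
    have h3 := le_rungFoot hm
    rw [pow_succ] at h2
    omega
  | succ n hn ih =>
    have h1 := rungFoot_add n
    have h2 := rungFoot_add (n + 1)
    rw [pow_succ] at h2
    omega

theorem rungFoot_injOn {m n : ℕ} (hm : 1 ≤ m) (hn : 1 ≤ n) (h : rungFoot m = rungFoot n) :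
    m = n := by
  rcases lt_trichotomy m n with hlt | heq | hgt
  · have := rungFoot_gap hm hlt
    omega
  · exact heq
  · have := rungFoot_gap hn hgt
    omega

theorem IsRungFoot.not_succ {j : ℕ} (h : IsRungFoot j) : ¬ IsRungFoot (j + 1) := by
  rintro ⟨n, hn, h1⟩
  obtain ⟨m, hm, rfl⟩ := h
  rcases lt_or_ge m n with hlt | hge
  · have := rungFoot_gap hm hlt
    omega
  · rcases hge.lt_or_eq with hlt | rfl
    · have := rungFoot_gap hn hlt
      omega
    · omega

theorem not_isRungFoot_zero : ¬ IsRungFoot 0 := by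
  rintro ⟨n, hn, h⟩
  have := le_rungFoot hn
  omega

open Classical in
/-- The potential on the lower lines: the edge `t_{j+1} → t_j` has weight
`lowerScale j / lowerScale (j + 1)`, so that the lower lines are diagonally conjugate to unweighted
shifts. -/
noncomputable def lowerScale (j : ℕ) : ℝ := if IsRungFoot j then 1 / 2 else 1

theorem lowerScale_pos (j : ℕ) : 0 < lowerScale j := by
  unfold lowerScale; split_ifs <;> norm_num

theorem half_le_lowerScale (j : ℕ) : 1 / 2 ≤ lowerScale j := by
  unfold lowerScale; split_ifs <;> norm_num

theorem lowerScale_le_one (j : ℕ) : lowerScale j ≤ 1 := by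
  unfold lowerScale; split_ifs <;> norm_num

theorem lowerScale_rungFoot {n : ℕ} (hn : 1 ≤ n) : lowerScale (rungFoot n) = 1 / 2 :=
  if_pos ⟨n, hn, rfl⟩

theorem ladderWeight_lower_lower (k j : ℕ) :
    ladderWeight (.lower k (j + 1)) (.lower k j) = lowerScale j / lowerScale (j + 1) := by
  unfold lowerScale
  by_cases h : IsRungFoot j
  · simp [ladderWeight, h, h.not_succ]
  · by_cases h' : IsRungFoot (j + 1) <;> simp [ladderWeight, h, h']

/-! ### Nonnegativity of the weights and incoming edges -/

theorem ladderWeight_nonneg (a b : LadderVertex) : 0 ≤ ladderWeight a b := by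
  cases a <;> cases b <;> simp only [ladderWeight, le_refl] <;> split_ifs <;> norm_num

theorem hasSum_source (f : LadderVertex → ℝ) :
    HasSum (fun v => f v * ladderWeight v .source) 0 := by
  convert hasSum_zero with v
  cases v <;> simp [ladderWeight]

theorem hasSum_origin_zero (f : LadderVertex → ℝ) :
    HasSum (fun v => f v * ladderWeight v (.origin 0)) (f .source) := by
  convert hasSum_single LadderVertex.source fun v hv => ?_
  · simp [ladderWeight]
  · cases v <;> simp_all [ladderWeight]

theorem hasSum_origin_succ (f : LadderVertex → ℝ) (k : ℕ) :
    HasSum (fun v => f v * ladderWeight v (.origin (k + 1))) (f (.origin k)) := by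
  convert hasSum_single (LadderVertex.origin k) fun v hv => ?_
  · simp [ladderWeight]
  · cases v <;> simp_all [ladderWeight, eq_comm]

theorem hasSum_upper_zero (f : LadderVertex → ℝ) (k : ℕ) :
    HasSum (fun v => f v * ladderWeight v (.upper k 0)) (f (.origin k)) := by
  convert hasSum_single (LadderVertex.origin k) fun v hv => ?_
  · simp [ladderWeight]
  · cases v <;> simp_all [ladderWeight, eq_comm]

theorem hasSum_upper_succ (f : LadderVertex → ℝ) (k i : ℕ) :
    HasSum (fun v => f v * ladderWeight v (.upper k (i + 1))) (f (.upper k i)) := by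
  convert hasSum_single (LadderVertex.upper k i) fun v hv => ?_
  · simp [ladderWeight]
  · cases v <;> simp_all [ladderWeight]
    rintro rfl
    aesop

theorem hasSum_lower {k j : ℕ} (hj : ∀ i, j ≠ rungFoot (k + 1 + i)) (f : LadderVertex → ℝ) :
    HasSum (fun v => f v * ladderWeight v (.lower k j))
      (lowerScale j * (f (.lower k (j + 1)) / lowerScale (j + 1))) := by
  convert hasSum_single (LadderVertex.lower k (j + 1)) fun v hv => ?_ using 1
  · rw [ladderWeight_lower_lower]; ring
  · cases v with
    | upper l i =>
      rw [ladderWeight, if_neg, mul_zero]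
      rintro ⟨rfl, h⟩
      exact hj i h
    | lower l j' =>
      rw [ladderWeight, if_neg, mul_zero]
      rintro ⟨rfl, rfl⟩
      exact hv rfl
    | _ => simp [ladderWeight]

/-- At a rung position the vertex `t_j` has two predecessors, the next vertex of the lower line and the
start of the rung; the weight `1 / 2` of the rung is the common factor `lowerScale j`. -/
theorem hasSum_lower_rungFoot (k i : ℕ) (f : LadderVertex → ℝ) :
    HasSum (fun v => f v * ladderWeight v (.lower k (rungFoot (k + 1 + i))))
      (lowerScale (rungFoot (k + 1 + i)) *
        (f (.lower k (rungFoot (k + 1 + i) + 1)) / lowerScale (rungFoot (k + 1 + i) + 1)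
          + f (.upper k i))) := by
  classical
  convert hasSum_sum_of_ne_finset_zero (L := .unconditional LadderVertex)
    (s := {LadderVertex.lower k (rungFoot (k + 1 + i) + 1), LadderVertex.upper k i})
    fun v hv => ?_ using 1
  · rw [Finset.sum_pair (by simp), ladderWeight_lower_lower, lowerScale_rungFoot (by omega)]
    simp [ladderWeight]
    ring
  · cases v with
    | upper l i' =>
      simp only [ladderWeight, mul_eq_zero, ite_eq_right_iff]
      right
      rintro ⟨rfl, h⟩
      have := rungFoot_injOn (by omega) (by omega) h
      obtain rfl : i = i' := by omega
      simp at hv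
    | lower l j' =>
      simp only [ladderWeight, mul_eq_zero]
      right
      rw [if_neg]
      rintro ⟨rfl, rfl⟩
      simp at hv
    | _ => simp [ladderWeight]

/-! ### The ladder graph is a `c₀`-graph -/

theorem exists_hasSum_ladderWeight (u : LadderVertex) :
    ∃ c ≤ (3 : ℝ), HasSum (fun v => ladderWeight v u) c := by
  match u with
  | .source => exact ⟨0, by norm_num, by simpa using hasSum_source fun _ => 1⟩
  | .origin 0 => exact ⟨1, by norm_num, by simpa using hasSum_origin_zero fun _ => 1⟩
  | .origin (k + 1) => exact ⟨1, by norm_num, by simpa using hasSum_origin_succ (fun _ => 1) k⟩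
  | .upper k 0 => exact ⟨1, by norm_num, by simpa using hasSum_upper_zero (fun _ => 1) k⟩
  | .upper k (i + 1) => exact ⟨1, by norm_num, by simpa using hasSum_upper_succ (fun _ => 1) k i⟩
  | .lower k j =>
    have h1 := lowerScale_le_one j
    have h2 := lowerScale_pos j
    have h3 : 1 / lowerScale (j + 1) ≤ 2 := by
      rw [div_le_iff₀ (lowerScale_pos _)]
      linarith [half_le_lowerScale (j + 1)]
    have h4 : 0 < 1 / lowerScale (j + 1) := one_div_pos.2 (lowerScale_pos _)
    by_cases hj : ∃ i, j = rungFoot (k + 1 + i)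
    · obtain ⟨i, rfl⟩ := hj
      have H := hasSum_lower_rungFoot k i fun _ => 1
      simp only [one_mul] at H
      exact ⟨_, by nlinarith, H⟩
    · have H := hasSum_lower (not_exists.1 hj) fun _ => 1
      simp only [one_mul] at H
      exact ⟨_, by nlinarith, H⟩

theorem finite_setOf_ladderWeight_ne_zero (a : LadderVertex) :
    {b | ladderWeight a b ≠ 0}.Finite := by
  match a with
  | .source =>
    refine (Set.finite_singleton (.origin 0)).subset fun b hb => ?_
    cases b <;> simp_all [ladderWeight]
  | .origin k =>
    refine (Set.toFinite {.origin (k + 1), .upper k 0}).subset fun b hb => ?_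
    cases b <;> simp_all [ladderWeight]
  | .upper k i =>
    refine (Set.toFinite {.upper k (i + 1), .lower k (rungFoot (k + 1 + i))}).subset fun b hb => ?_
    cases b <;> simp_all [ladderWeight]
  | .lower k j =>
    refine (Set.finite_singleton (.lower k (j - 1))).subset fun b hb => ?_
    cases b <;> simp_all [ladderWeight]

instance : Infinite LadderVertex :=
  Infinite.of_injective LadderVertex.origin fun _ _ h => by simpa using h

instance : Countable LadderVertex := by
  refine Function.Injective.countable (β := ℕ × ℕ × ℕ) (f := fun
    | .source => (0, 0, 0)
    | .origin k => (1, k, 0)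
    | .upper k i => (2, k, i)
    | .lower k j => (3, k, j)) fun a b h => ?_
  cases a <;> cases b <;> simp_all

theorem isC0Graph_ladderWeight (e : LadderVertex ≃ ℕ) :
    IsC0Graph fun u v => ladderWeight (e.symm u) (e.symm v) where
  nonneg _ _ := ladderWeight_nonneg _ _
  tendsto_zero u := by
    refine tendsto_const_nhds.congr' ?_
    rw [← Nat.cofinite_eq_atTop]
    have h := (finite_setOf_ladderWeight_ne_zero (e.symm u)).preimage e.symm.injective.injOn
    filter_upwards [h.compl_mem_cofinite] with v hv
    exact (not_not.1 hv).symm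
  bounded := by
    refine ⟨3, fun u => ?_⟩
    obtain ⟨c, hc, h⟩ := exists_hasSum_ladderWeight (e.symm u)
    have h' := e.symm.hasSum_iff.2 h
    exact ⟨h'.summable, h'.tsum_eq.trans_le hc⟩

/-! ### Bounds for the powers -/

open Classical in
/-- A nonnegative function `pathBound n` on the vertices, bounding the total weight of all paths of
length `n` that end in a given vertex. A vertex `o_k` or `s_n` is the end of at most one path of each
length. On a lower line, the paths inside the line contribute at most `2`, and since the windows
`rungFoot m < n + j ≤ 2 ^ (m + 1)` are disjoint, at most one further path enters through a rung. -/
noncomputable def pathBound (n : ℕ) : LadderVertex → ℝ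
  | .source => if n = 0 then 1 else 0
  | .origin k => if n ≤ k + 1 then 1 else 0
  | .upper k i => if n ≤ k + i + 2 then 1 else 0
  | .lower _ j => lowerScale j *
      if ∃ m, 1 ≤ m ∧ j ≤ rungFoot m ∧ rungFoot m < n + j ∧ n + j ≤ 2 ^ (m + 1) then 3 else 2

theorem pathBound_le (n : ℕ) (u : LadderVertex) : pathBound n u ≤ 3 := by
  cases u with
  | lower k j =>
    have h1 := lowerScale_le_one j
    have h2 := lowerScale_pos j
    rw [pathBound]
    split_ifs <;> linarith
  | _ => rw [pathBound]; split_ifs <;> norm_num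

theorem one_le_pathBound_zero (u : LadderVertex) : 1 ≤ pathBound 0 u := by
  cases u with
  | lower k j =>
    have h2 := half_le_lowerScale j
    rw [pathBound]
    split_ifs <;> linarith
  | _ => simp [pathBound]

theorem hasSum_pathBound (n : ℕ) (u : LadderVertex) :
    ∃ c ≤ pathBound (n + 1) u, HasSum (fun v => pathBound n v * ladderWeight v u) c := by
  match u with
  | .source => exact ⟨_, by simp [pathBound], hasSum_source _⟩
  | .origin 0 => exact ⟨_, by simp [pathBound], hasSum_origin_zero _⟩
  | .origin (k + 1) => exact ⟨_, by simp [pathBound], hasSum_origin_succ _ k⟩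
  | .upper k 0 => exact ⟨_, by simp [pathBound], hasSum_upper_zero _ k⟩
  | .upper k (i + 1) =>
    refine ⟨_, le_of_eq ?_, hasSum_upper_succ _ k i⟩
    simp only [pathBound]
    exact if_congr (by omega) rfl rfl
  | .lower k j =>
    -- A window that is open for `(n, j + 1)` is open for `(n + 1, j)`.
    have hmono : (∃ m, 1 ≤ m ∧ j + 1 ≤ rungFoot m ∧ rungFoot m < n + (j + 1) ∧
        n + (j + 1) ≤ 2 ^ (m + 1)) → ∃ m, 1 ≤ m ∧ j ≤ rungFoot m ∧ rungFoot m < n + 1 + j ∧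
        n + 1 + j ≤ 2 ^ (m + 1) := by
      rintro ⟨m, h1, h2, h3, h4⟩
      exact ⟨m, h1, by omega, by omega, by omega⟩
    by_cases hj : ∃ i, j = rungFoot (k + 1 + i)
    · obtain ⟨i, hi⟩ := hj
      have H := hasSum_lower_rungFoot k i (pathBound n)
      rw [← hi] at H
      refine ⟨_, ?_, H⟩
      simp only [pathBound]
      rw [mul_div_cancel_left₀ _ (lowerScale_pos _).ne']
      refine mul_le_mul_of_nonneg_left ?_ (lowerScale_pos j).le
      have h2 := rungFoot_add (k + 1 + i)
      rw [← hi] at h2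
      -- Mass entering at `j = rungFoot m` at time `n` requires `n ≤ m + 1`, and then no mass
      -- from a rung further up arrives at the same time.
      by_cases hn : n ≤ k + i + 2
      · rw [if_pos hn, if_neg, if_pos]
        · norm_num
        · exact ⟨k + 1 + i, by omega, hi.le, by omega, by omega⟩
        · rintro ⟨m, hm, h3, h4, -⟩
          have hlt : k + 1 + i < m := by
            by_contra hle
            rcases (not_lt.1 hle).lt_or_eq with h5 | rfl
            · have := rungFoot_gap hm h5
              omega
            · omega
          have := rungFoot_gap (by omega) hlt
          omega
      · rw [if_neg hn, add_zero]
        split_ifs with h3 h4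
        exacts [le_rfl, absurd (hmono h3) h4, by norm_num, le_rfl]
    · refine ⟨_, ?_, hasSum_lower (not_exists.1 hj) _⟩
      simp only [pathBound]
      rw [mul_div_cancel_left₀ _ (lowerScale_pos _).ne']
      refine mul_le_mul_of_nonneg_left ?_ (lowerScale_pos j).le
      split_ifs with h3 h4
      exacts [le_rfl, absurd (hmono h3) h4, by norm_num, le_rfl]

/-- The defining series of the associated operator, summed over the vertices themselves. -/
theorem IsAssociatedOp.hasSum_vertex {e : LadderVertex ≃ ℕ} {T : C₀(ℕ, ℝ) →L[ℝ] C₀(ℕ, ℝ)}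
    (hT : IsAssociatedOp (fun u v => ladderWeight (e.symm u) (e.symm v)) T) (x : C₀(ℕ, ℝ))
    (u : LadderVertex) : HasSum (fun v => x (e v) * ladderWeight v u) (T x (e u)) := by
  simpa [Function.comp_def] using e.hasSum_iff.2 (hT x (e u))

theorem IsAssociatedOp.abs_pow_apply_le {e : LadderVertex ≃ ℕ} {T : C₀(ℕ, ℝ) →L[ℝ] C₀(ℕ, ℝ)}
    (hT : IsAssociatedOp (fun u v => ladderWeight (e.symm u) (e.symm v)) T) (x : C₀(ℕ, ℝ)) (n : ℕ)
    (u : LadderVertex) : |(T ^ n) x (e u)| ≤ pathBound n u * ‖x‖ := by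
  induction n generalizing u with
  | zero =>
    refine (C0.abs_apply_le_norm x (e u)).trans ?_
    exact le_mul_of_one_le_left (norm_nonneg x) (one_le_pathBound_zero u)
  | succ n ih =>
    obtain ⟨c, hc, h⟩ := hasSum_pathBound n u
    have h1 := hT.hasSum_vertex ((T ^ n) x) u
    rw [pow_succ', mul_apply_eq_comp]
    refine le_trans ?_ (mul_le_mul_of_nonneg_right hc (norm_nonneg x))
    rw [← h1.tsum_eq]
    refine tsum_of_norm_bounded (f := fun v => (T ^ n) x (e v) * ladderWeight v u)
      (h.mul_right ‖x‖) fun v => ?_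
    rw [Real.norm_eq_abs, abs_mul, abs_of_nonneg (ladderWeight_nonneg v u), mul_right_comm]
    exact mul_le_mul_of_nonneg_right (ih v) (ladderWeight_nonneg v u)

theorem IsAssociatedOp.norm_pow_le {e : LadderVertex ≃ ℕ} {T : C₀(ℕ, ℝ) →L[ℝ] C₀(ℕ, ℝ)}
    (hT : IsAssociatedOp (fun u v => ladderWeight (e.symm u) (e.symm v)) T) (n : ℕ) :
    ‖T ^ n‖ ≤ 3 := by
  refine ContinuousLinearMap.opNorm_le_bound _ (by norm_num) fun x => ?_
  refine (C0.norm_le_iff (mul_nonneg (by norm_num) (norm_nonneg x))).2 fun k => ?_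
  have h := hT.abs_pow_apply_le x n (e.symm k)
  rw [e.apply_symm_apply] at h
  exact h.trans (mul_le_mul_of_nonneg_right (pathBound_le n _) (norm_nonneg x))

/-! ### The orbit of the source -/

open Classical in
/-- The total weight of the paths of length `n` from `s` to a given vertex. Such a path reaches `t_j`
through the rung at `rungFoot m` exactly when `n + j = 2 ^ (m + 1)`. -/
noncomputable def sourceOrbit (n : ℕ) : LadderVertex → ℝ
  | .source => if n = 0 then 1 else 0
  | .origin k => if n = k + 1 then 1 else 0
  | .upper k i => if n = k + i + 2 then 1 else 0
  | .lower k j => lowerScale j *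
      if ∃ m, k + 1 ≤ m ∧ j ≤ rungFoot m ∧ n + j = 2 ^ (m + 1) then 1 else 0

theorem hasSum_sourceOrbit (n : ℕ) (u : LadderVertex) :
    HasSum (fun v => sourceOrbit n v * ladderWeight v u) (sourceOrbit (n + 1) u) := by
  classical
  match u with
  | .source =>
    convert hasSum_source _
    simp [sourceOrbit]
  | .origin 0 =>
    convert hasSum_origin_zero _ using 1
    simp [sourceOrbit]
  | .origin (k + 1) =>
    convert hasSum_origin_succ _ k using 1
    simp [sourceOrbit]
  | .upper k 0 =>
    convert hasSum_upper_zero _ k using 1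
    simp [sourceOrbit]
  | .upper k (i + 1) =>
    convert hasSum_upper_succ _ k i using 1
    exact if_congr (by omega) rfl rfl
  | .lower k j =>
    by_cases hj : ∃ i, j = rungFoot (k + 1 + i)
    · obtain ⟨i, hi⟩ := hj
      have H := hasSum_lower_rungFoot k i (sourceOrbit n)
      rw [← hi] at H
      convert H using 1
      simp only [sourceOrbit]
      rw [mul_div_cancel_left₀ _ (lowerScale_pos _).ne']
      congr 1
      have h2 := rungFoot_add (k + 1 + i)
      rw [← hi] at h2
      by_cases hn : n = k + i + 2
      · rw [if_pos hn, if_pos, if_neg, zero_add]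
        · rintro ⟨m, hm, h3, h4⟩
          have h5 : 2 ^ (m + 1) = 2 ^ (k + 1 + i + 1) := by omega
          have h6 := Nat.pow_right_injective le_rfl h5
          obtain rfl : m = k + 1 + i := by omega
          omega
        · exact ⟨k + 1 + i, by omega, hi.le, by omega⟩
      · rw [if_neg hn, add_zero]
        refine if_congr ⟨?_, ?_⟩ rfl rfl
        · rintro ⟨m, hm, h3, h4⟩
          refine ⟨m, hm, ?_, by omega⟩
          rcases h3.lt_or_eq with h5 | h5
          · exact h5
          · obtain rfl := rungFoot_injOn (by omega) (by omega) (h5.symm.trans hi)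
            omega
        · rintro ⟨m, hm, h3, h4⟩
          exact ⟨m, hm, by omega, by omega⟩
    · convert hasSum_lower (not_exists.1 hj) _ using 1
      simp only [sourceOrbit]
      rw [mul_div_cancel_left₀ _ (lowerScale_pos _).ne']
      congr 1
      refine if_congr ⟨?_, ?_⟩ rfl rfl
      · rintro ⟨m, hm, h3, h4⟩
        refine ⟨m, hm, ?_, by omega⟩
        refine h3.lt_of_ne fun h5 => hj ⟨m - (k + 1), ?_⟩
        rwa [Nat.add_sub_cancel' hm]
      · rintro ⟨m, hm, h3, h4⟩
        exact ⟨m, hm, by omega, by omega⟩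

theorem IsAssociatedOp.pow_single_source {e : LadderVertex ≃ ℕ} {T : C₀(ℕ, ℝ) →L[ℝ] C₀(ℕ, ℝ)}
    (hT : IsAssociatedOp (fun u v => ladderWeight (e.symm u) (e.symm v)) T) (n : ℕ)
    (u : LadderVertex) : (T ^ n) (C0.single (e .source)) (e u) = sourceOrbit n u := by
  induction n generalizing u with
  | zero =>
    rw [pow_zero, one_apply_eq_self, C0.single_apply]
    cases u with
    | lower k j =>
      simp only [sourceOrbit]
      rw [if_neg (by simp), if_neg, mul_zero]
      rintro ⟨m, -, h1, h2⟩
      have := rungFoot_add m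
      omega
    | _ => simp [sourceOrbit]
  | succ n ih =>
    rw [pow_succ', mul_apply_eq_comp]
    refine (hT.hasSum_vertex _ u).unique ?_
    simpa only [ih] using hasSum_sourceOrbit n u

theorem sourceOrbit_nonneg (n : ℕ) (u : LadderVertex) : 0 ≤ sourceOrbit n u := by
  cases u <;> rw [sourceOrbit]
  case lower k j => exact mul_nonneg (lowerScale_pos j).le (by split_ifs <;> norm_num)
  all_goals split_ifs <;> norm_num

theorem sourceOrbit_le_one (n : ℕ) (u : LadderVertex) : sourceOrbit n u ≤ 1 := by
  cases u <;> rw [sourceOrbit]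
  case lower k j =>
    have := lowerScale_le_one j
    split_ifs <;> linarith
  all_goals split_ifs <;> norm_num

theorem exists_half_le_sourceOrbit (u : LadderVertex) : ∃ n, 1 / 2 ≤ sourceOrbit n u := by
  cases u with
  | source => exact ⟨0, by norm_num [sourceOrbit]⟩
  | origin k => exact ⟨k + 1, by norm_num [sourceOrbit]⟩
  | upper k i => exact ⟨k + i + 2, by norm_num [sourceOrbit]⟩
  | lower k j =>
    have h1 := le_rungFoot (n := k + 1 + j) (by omega)
    have h2 := rungFoot_add (k + 1 + j)
    refine ⟨2 ^ (k + 1 + j + 1) - j, ?_⟩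
    rw [sourceOrbit, if_pos ⟨k + 1 + j, by omega, by omega, by omega⟩, mul_one]
    exact half_le_lowerScale j

/-- The times at which a fixed vertex is charged at least double from one to the next. -/
theorem two_mul_le_of_sourceOrbit_ne_zero {u : LadderVertex} {n n' : ℕ} (h : sourceOrbit n u ≠ 0)
    (h' : sourceOrbit n' u ≠ 0) (hlt : n < n') : 2 * n ≤ n' := by
  cases u with
  | lower k j =>
    simp only [sourceOrbit, ne_eq, mul_eq_zero, (lowerScale_pos j).ne', false_or, ite_eq_right_iff,
      one_ne_zero, imp_false, not_not] at h h'
    obtain ⟨m, -, -, h2⟩ := h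
    obtain ⟨m', -, -, h2'⟩ := h'
    have h3 : 2 ^ (m + 1) < 2 ^ (m' + 1) := by omega
    have h4 := (Nat.pow_lt_pow_iff_right (by norm_num)).1 h3
    have h5 : 2 ^ (m + 1 + 1) ≤ 2 ^ (m' + 1) := Nat.pow_le_pow_right (by norm_num) (by omega)
    rw [pow_succ] at h5
    omega
  | _ =>
    simp only [sourceOrbit, ne_eq, ite_eq_right_iff, one_ne_zero, imp_false, not_not] at h h'
    omega

theorem card_filter_sourceOrbit_le (N : ℕ) (u : LadderVertex) :
    ((Finset.range N).filter fun n => sourceOrbit n u ≠ 0).card ≤ Nat.log 2 N + 2 := by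
  -- Apart from `n = 0`, a time is determined by the integer part of its binary logarithm.
  have h1 : (((Finset.range N).filter fun n => sourceOrbit n u ≠ 0).erase 0).card
      ≤ (Finset.range (Nat.log 2 N + 1)).card := by
    refine Finset.card_le_card_of_injOn (Nat.log 2) (fun n hn => ?_) fun n hn n' hn' hlog => ?_
    · simp only [Finset.coe_erase, Set.mem_sdiff, Finset.mem_coe, Finset.mem_filter,
        Finset.mem_range] at hn
      simpa [Nat.lt_succ_iff] using Nat.log_mono_right hn.1.1.le
    · have key : ∀ {a b : ℕ}, a ≠ 0 → sourceOrbit a u ≠ 0 → sourceOrbit b u ≠ 0 → a < b →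
          Nat.log 2 a < Nat.log 2 b := fun {a b} ha h h' hlt => by
        have h3 := Nat.log_mono_right (b := 2) (two_mul_le_of_sourceOrbit_ne_zero h h' hlt)
        rw [mul_comm, Nat.log_mul_base (by norm_num) ha] at h3
        omega
      simp only [Finset.coe_erase, Set.mem_sdiff, Finset.mem_coe, Finset.mem_filter,
        Finset.mem_range, Set.mem_singleton_iff] at hn hn'
      rcases lt_trichotomy n n' with h | h | h
      · exact absurd hlog (key hn.2 hn.1.2 hn'.1.2 h).ne
      · exact h
      · exact absurd hlog (key hn'.2 hn'.1.2 hn.1.2 h).ne'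
  have h2 := Finset.pred_card_le_card_erase
    (s := (Finset.range N).filter fun n => sourceOrbit n u ≠ 0) (a := 0)
  rw [Finset.card_range] at h1
  omega

theorem sum_sourceOrbit_le (N : ℕ) (u : LadderVertex) :
    ∑ n ∈ Finset.range N, sourceOrbit n u ≤ Nat.log 2 N + 2 := by
  rw [← Finset.sum_filter_ne_zero]
  refine (Finset.sum_le_card_nsmul _ _ 1 fun n _ => sourceOrbit_le_one n u).trans ?_
  rw [nsmul_one]
  exact_mod_cast card_filter_sourceOrbit_le N u

theorem tendsto_inv_mul_log : Tendsto (fun N : ℕ => (N : ℝ)⁻¹ * (Nat.log 2 N + 2)) atTop (𝓝 0) := by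
  have h1 : Tendsto (fun N : ℕ => Real.log N / N) atTop (𝓝 0) := by
    have := Real.isLittleO_log_id_atTop.tendsto_div_nhds_zero.comp tendsto_natCast_atTop_atTop
    exact this
  have h2 := (h1.const_mul (Real.log 2)⁻¹).add
    (tendsto_inv_atTop_nhds_zero_nat (𝕜 := ℝ) |>.mul_const 2)
  rw [mul_zero, zero_mul, add_zero] at h2
  refine squeeze_zero (fun N => by positivity) (fun N => ?_) h2
  have h3 : (Nat.log 2 N : ℝ) ≤ Real.log N / Real.log 2 := by
    simpa [Real.logb] using Real.natLog_le_logb N 2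
  calc (N : ℝ)⁻¹ * (Nat.log 2 N + 2) ≤ (N : ℝ)⁻¹ * (Real.log N / Real.log 2 + 2) := by gcongr
    _ = _ := by ring

theorem IsAssociatedOp.tendsto_average_source {e : LadderVertex ≃ ℕ}
    {T : C₀(ℕ, ℝ) →L[ℝ] C₀(ℕ, ℝ)}
    (hT : IsAssociatedOp (fun u v => ladderWeight (e.symm u) (e.symm v)) T) :
    Tendsto (fun N : ℕ => (N : ℝ)⁻¹ * ‖∑ n ∈ Finset.range N, (T ^ n) (C0.single (e .source))‖)
      atTop (𝓝 0) := by
  refine squeeze_zero (fun N => by positivity) (fun N => ?_) tendsto_inv_mul_log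
  refine mul_le_mul_of_nonneg_left ((C0.norm_le_iff (by positivity)).2 fun k => ?_) (by positivity)
  obtain ⟨u, rfl⟩ := e.surjective k
  rw [C0.sum_apply]
  simp only [hT.pow_single_source]
  rw [abs_of_nonneg (Finset.sum_nonneg fun n _ => sourceOrbit_nonneg n u)]
  exact sum_sourceOrbit_le N u

theorem IsAssociatedOp.exists_single_le {e : LadderVertex ≃ ℕ} {T : C₀(ℕ, ℝ) →L[ℝ] C₀(ℕ, ℝ)}
    (hT : IsAssociatedOp (fun u v => ladderWeight (e.symm u) (e.symm v)) T) (k : ℕ) :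
    ∃ (p : ℕ) (c : ℝ), 0 ≤ c ∧
      ∀ l, C0.single k l ≤ c * (T ^ p) (C0.single (e .source)) l := by
  obtain ⟨u, rfl⟩ := e.surjective k
  obtain ⟨p, hp⟩ := exists_half_le_sourceOrbit u
  refine ⟨p, 2, by norm_num, fun l => ?_⟩
  obtain ⟨v, rfl⟩ := e.surjective l
  rw [hT.pow_single_source, C0.single_apply]
  have h := sourceOrbit_nonneg p v
  split_ifs with hv
  · rw [e.injective hv]
    linarith
  · linarith

/-- At the times `2 ^ (m + 1)` all vertices `v_k` with `k < m` carry mass `1`. -/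
theorem sourceOrbit_two_pow {k m : ℕ} (h : k + 1 ≤ m) :
    sourceOrbit (2 ^ (m + 1)) (.lower k 0) = 1 := by
  rw [sourceOrbit, if_pos ⟨m, h, Nat.zero_le _, rfl⟩, lowerScale, if_neg not_isRungFoot_zero,
    mul_one]

theorem mainTheorem2 :
    ∃ (e : LadderVertex ≃ ℕ) (T : C₀(ℕ, ℝ) →L[ℝ] C₀(ℕ, ℝ)),
      IsC0Graph (fun u v => ladderWeight (e.symm u) (e.symm v)) ∧
      IsAssociatedOp (fun u v => ladderWeight (e.symm u) (e.symm v)) T ∧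
      IsPositiveOp T ∧
      (∀ n : ℕ, ‖T ^ n‖ ≤ 4) ∧
      (∀ m : ℕ, IsMeanErgodic (T ^ m)) ∧
      ¬ IsWeaklyAlmostPeriodic T := by
  obtain ⟨_⟩ := nonempty_denumerable LadderVertex
  let e := Denumerable.eqv LadderVertex
  have hw := isC0Graph_ladderWeight e
  obtain ⟨T, hT⟩ := hw.exists_isAssociatedOp
  have hpos := hT.isPositiveOp hw.nonneg
  refine ⟨e, T, hw, hT, hpos, fun n => (hT.norm_pow_le n).trans (by norm_num), fun m => ?_, ?_⟩
  · refine hpos.isMeanErgodic_pow hT.norm_pow_le (fun n => ?_) hT.exists_single_le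
      hT.tendsto_average_source m
    rw [C0.single_apply]
    split_ifs <;> norm_num
  · refine not_isWeaklyAlmostPeriodic_of_eventually_eq_one (x := C0.single (e .source))
      (fun m => 2 ^ (m + 1)) (b := fun k => e (.lower k 0)) (fun k l h => ?_) fun k => ?_
    · simpa using h
    · filter_upwards [eventually_ge_atTop (k + 1)] with m hm
      rw [hT.pow_single_source, sourceOrbit_two_pow hm]
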